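/- Let $f\colon X\to Y$ be a dominant morphism, locally of finite type, between normal integral schemes (for instance, any dominant morphism between normal integral schemes of finite type over a field $k$). Let $x\colon \operatorname{Spec}\Omega\to X$ be a geometric point ($\Omega$ a separably closed field, e.g. an algebraically closed one) and let $y=f\circ x$ be its image in $Y$. Then the image of the induced homomorphism $f_*\colon \pi_1(X,x)\to\pi_1(Y,y)$ of étale fundamental groups is a subgroup of finite index of $\pi_1(Y,y)$. Here $\pi_1(X,x)$ denotes the automorphism group of the fibre functor $Z\mapsto \operatorname{Hom}_X(\operatorname{Spec}\Omega,Z)$ on the category of finite étale coverings $Z\to X$, and $f_*$ is induced by base change of coverings along $f$. -/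

import Mathlib

open CategoryTheory AlgebraicGeometry

universe u

namespace EtaleFundamentalGroup

/-- A scheme is normal if all its local rings are integrally closed domains. -/
def IsNormalScheme (X : Scheme.{u}) : Prop :=
  ∀ x : X, IsDomain (X.presheaf.stalk x) ∧ IsIntegrallyClosed (X.presheaf.stalk x)

/-- The property of being a finite étale morphism of schemes. -/
abbrev finiteEtale : MorphismProperty Scheme.{u} := @IsFinite ⊓ @Etale

instance : finiteEtale.{u}.IsStableUnderBaseChange :=
  MorphismProperty.IsStableUnderBaseChange.inf

/-- The category of finite étale coverings of `X`: its objects are the finite étale morphisms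
`Y ⟶ X`, its morphisms are all morphisms of `X`-schemes. -/
abbrev FEt (X : Scheme.{u}) := finiteEtale.{u}.Over ⊤ X

/-- The fibre functor at a geometric point `x : Spec Ω ⟶ X`: it sends a finite étale covering
`Y` of `X` to the set of geometric points of `Y` above `x`, that is, the set of `X`-morphisms
from `Spec Ω` to `Y`. -/
noncomputable def fiberFunctor {X : Scheme.{u}} {Ω : Type u} [Field Ω] (x : Spec (.of Ω) ⟶ X) :
    FEt X ⥤ Type u :=
  MorphismProperty.Over.forget finiteEtale ⊤ X ⋙ coyoneda.obj (Opposite.op (Over.mk x))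

/-- The étale fundamental group `π₁(X, x)`: the automorphism group of the fibre functor. -/
abbrev Pi1 (X : Scheme.{u}) {Ω : Type u} [Field Ω] (x : Spec (.of Ω) ⟶ X) :=
  Aut (fiberFunctor x)

/-- Base change of finite étale coverings along `f : X ⟶ Y`. -/
noncomputable abbrev baseChange {X Y : Scheme.{u}} (f : X ⟶ Y) : FEt Y ⥤ FEt X :=
  MorphismProperty.Over.pullback finiteEtale ⊤ f

/-- The fibre at `x` of the base change along `f : X ⟶ Y` of a covering `Z` of `Y` is identified
with the fibre of `Z` at the geometric point `f(x) = x ≫ f`, by the universal property of the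
fibre product: a point of `Z ×_Y X` above `x` goes to its first projection. -/
noncomputable def fiberBaseChangeIso {X Y : Scheme.{u}} (f : X ⟶ Y) {Ω : Type u} [Field Ω]
    (x : Spec (.of Ω) ⟶ X) :
    baseChange f ⋙ fiberFunctor x ≅ fiberFunctor (x ≫ f) :=
  NatIso.ofComponents (fun Z ↦ Equiv.toIso
    (((Over.mapPullbackAdj f).homEquiv (Over.mk x) Z.toComma).symm))
    (fun {Z Z'} g ↦ by
      ext t
      exact (Over.mapPullbackAdj f).homEquiv_naturality_right_symm _ _)

/-- The homomorphism `f_* : π₁(X, x) → π₁(Y, f(x))` induced by `f : X ⟶ Y`: an automorphism of the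
fibre functor at `x` acts on the fibre at `f(x)` of a covering `Z` of `Y` through the fibre at `x`
of the base change of `Z` to `X`. -/
noncomputable def pi1Map {X Y : Scheme.{u}} (f : X ⟶ Y) {Ω : Type u} [Field Ω]
    (x : Spec (.of Ω) ⟶ X) : Pi1 X x →* Pi1 Y (x ≫ f) :=
  (fiberBaseChangeIso f x).conjAut.toMonoidHom.comp
    (((Functor.whiskeringLeft _ _ (Type u)).obj (baseChange f)).mapAut (fiberFunctor x))

end EtaleFundamentalGroup

/-!
Let `K → L` be the extension of function fields of `X → Y`. It is finitely generated, so `L` is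
finite over a purely transcendental extension `K(t)` of `K`; let `n = [L : K(t)]`. The image of
`π₁(X)` in `π₁(Y)` has index at most `n`.

*Reduction to connected components.* For a covering `Z` of `Y`, two points of its fibre are called
joined if they lie in the same connected component of `Z ×[Y] X`. An automorphism `g` of the fibre
functor of `Y` that moves every point to a joined point comes from an automorphism of the fibre
functor of `X` (`HasConnectedPoints.exists_mapAut_eq`). Over finitely many coverings of `X`, the
required permutations are read off from a connected covering that dominates them, a morphism out of
a connected covering being determined by its value at one point; as fibres are finite, a compactness
argument does the rest. Neither Galois objects nor quotients of coverings by groups are needed.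
It follows that the index is at most `n` as soon as, among any `n + 1` translates of a point by
automorphisms, two are joined (`HasConnectedPoints.finiteIndex_range`).

*Counting components.* All translates of a point lie in one connected component of the covering, so
let `Z` be connected. Every connected component of `Z ×[Y] X` is clopen, hence maps onto `X` and
meets the fibre over the generic point (`exists_mem_connectedComponent`). That fibre is
`Spec (E ⊗[K] L)`, where `Spec E` is the generic fibre of `Z`.

*The generic fibre is connected.* This is where normality of `Y` enters: `Y` is its own
normalization in `Spec K`, and normalization commutes with étale base change, so `Z` is its own
normalization in `Spec E`. An idempotent of `E` therefore extends to `Z`, and `E` is a field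
(`IsNormalScheme.connectedSpace_genericFiber`).

*The bound.* The ring `E ⊗[K] K(t)` is a domain, being a localization of a polynomial ring over
`E`, and it is finite over `K(t)`, so it is a field. Over it `E ⊗[K] L` has dimension `n`, so it has
at most `n` prime ideals, whatever `E` is (`exists_card_primeSpectrum_tensorProduct_le`).
-/

/-! ### Automorphisms of set-valued functors with enough connected objects -/

section FibreFunctor

universe v₁ v₂ u₁ u₂ w

variable {C : Type u₁} [Category.{v₁} C] {D : Type u₂} [Category.{v₂} D]

/-- Any finite family of elements of the values of `F` comes from one element of one value. -/
structure HasDominatingPoints (F : C ⥤ Type w) : Prop where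
  exists_point : ∃ T, Nonempty (F.obj T)
  exists_dominating : ∀ (W W' : C) (w : F.obj W) (w' : F.obj W'),
    ∃ (T : C) (t : F.obj T) (p : T ⟶ W) (q : T ⟶ W'), F.map p t = w ∧ F.map q t = w'

/-- The functor `F` has finite values and behaves, with respect to the class `conn` of objects, as
a fibre functor does with respect to the connected coverings: every point lies on a connected
object, morphisms out of a connected object are determined by their value at one point, and
morphisms between connected objects are surjective on fibres. -/
structure HasConnectedPoints (F : C ⥤ Type w) (conn : C → Prop) : Prop
    extends HasDominatingPoints F where
  finite : ∀ W, Finite (F.obj W)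
  exists_conn : ∀ (T : C) (t : F.obj T), ∃ (c : C) (i : c ⟶ T) (s : F.obj c),
    conn c ∧ F.map i s = t
  rigid : ∀ {c W : C} (h h' : c ⟶ W) (s : F.obj c), conn c → F.map h s = F.map h' s → h = h'
  surj : ∀ {c c' : C} (h : c ⟶ c'), conn c → conn c' → Function.Surjective (F.map h)

/-- Two points of `F.obj T` are joined if they lie on a common connected object over `T`. -/
def JoinedPoints (F : C ⥤ Type w) (conn : C → Prop) {T : C} (t t' : F.obj T) : Prop :=
  ∃ (c : C) (i : c ⟶ T) (s s' : F.obj c), conn c ∧ F.map i s = t ∧ F.map i s' = t'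

lemma JoinedPoints.map {F : C ⥤ Type w} {conn : C → Prop} {T T' : C} (f : T ⟶ T') {t t' : F.obj T}
    (h : JoinedPoints F conn t t') : JoinedPoints F conn (F.map f t) (F.map f t') := by
  obtain ⟨c, i, s, s', hc, rfl, rfl⟩ := h
  exact ⟨c, i ≫ f, s, s', hc, by simp, by simp⟩

lemma HasDominatingPoints.of_iso {F G : C ⥤ Type w} (e : F ≅ G) (hF : HasDominatingPoints F) :
    HasDominatingPoints G where
  exists_point := by
    obtain ⟨T, ⟨t⟩⟩ := hF.exists_point
    exact ⟨T, ⟨e.hom.app T t⟩⟩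
  exists_dominating W W' w w' := by
    obtain ⟨T, t, p, q, hp, hq⟩ := hF.exists_dominating W W' (e.inv.app W w) (e.inv.app W' w')
    refine ⟨T, e.hom.app T t, p, q, ?_, ?_⟩
    · rw [← NatTrans.naturality_apply, hp, Iso.inv_hom_id_app_apply]
    · rw [← NatTrans.naturality_apply, hq, Iso.inv_hom_id_app_apply]

lemma HasDominatingPoints.exists_dominating_of_finite {F : C ⥤ Type w}
    (hF : HasDominatingPoints F) {S : Set (Σ W, F.obj W)} (hS : S.Finite) :
    ∃ (T : C) (t : F.obj T), ∀ w ∈ S, ∃ p : T ⟶ w.1, F.map p t = w.2 := by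
  induction S, hS using Set.Finite.induction_on with
  | empty =>
    obtain ⟨T, ⟨t⟩⟩ := hF.exists_point
    exact ⟨T, t, by simp⟩
  | @insert a S _ _ ih =>
    obtain ⟨T, t, h⟩ := ih
    obtain ⟨T', t', p, q, hp, hq⟩ := hF.exists_dominating T a.1 t a.2
    refine ⟨T', t', fun w hw ↦ ?_⟩
    obtain rfl | hw := hw
    · exact ⟨q, hq⟩
    · obtain ⟨r, hr⟩ := h w hw
      exact ⟨p ≫ r, by simp [hp, hr]⟩

lemma finite_points_of_mem {F : C ⥤ Type w} (hF : ∀ W, Finite (F.obj W)) (s : Finset C) :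
    {w : Σ W, F.obj W | w.1 ∈ s}.Finite := by
  refine (Set.Finite.biUnion s.finite_toSet
    (t := fun W ↦ Set.range (Sigma.mk W : F.obj W → _)) fun _ _ ↦ Set.finite_range _).subset ?_
  rintro ⟨W, p⟩ h
  simp only [Set.mem_iUnion]
  exact ⟨W, h, p, rfl⟩

variable {F : C ⥤ Type w} {conn : C → Prop} {P : D ⥤ C}

/-- On finitely many objects, an automorphism `g` of `P ⋙ F` moving every point to a joined point
is compatible with permutations of the values of `F`: a connected object `c` through a point that
dominates all points in question has another point over its `g`-translate, and the permutations are
read off from that point. -/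
lemma HasConnectedPoints.exists_partial (hF : HasConnectedPoints F conn)
    (hP : HasDominatingPoints (P ⋙ F)) (g : Aut (P ⋙ F))
    (hg : ∀ (Z : D) (z : (P ⋙ F).obj Z), JoinedPoints F conn (T := P.obj Z) z (g.hom.app Z z))
    (s : Finset C) (t : Finset D) :
    ∃ γ : ∀ W, F.obj W → F.obj W, (∀ W ∈ s, Function.Injective (γ W)) ∧
      (∀ W ∈ s, ∀ W' ∈ s, ∀ (φ : W ⟶ W') (p : F.obj W),
        F.map φ (γ W p) = γ W' (F.map φ p)) ∧
      ∀ Z ∈ t, P.obj Z ∈ s → ∀ p : F.obj (P.obj Z), γ (P.obj Z) p = g.hom.app Z p := by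
  classical
  have := hF.finite
  obtain ⟨Z, z, hz⟩ := hP.exists_dominating_of_finite
    (finite_points_of_mem (F := P ⋙ F) (fun W ↦ hF.finite _) t)
  obtain ⟨c, i, c₀, c₁, hc, h₀, h₁⟩ := hg Z z
  obtain ⟨T, τ, hT⟩ := hF.exists_dominating_of_finite (finite_points_of_mem hF.finite s)
  obtain ⟨T', τ', a, b, ha, hb⟩ := hF.exists_dominating T c τ c₀
  obtain ⟨d, j, δ, hd, hδ⟩ := hF.exists_conn T' τ'
  obtain ⟨δ', hδ'⟩ := hF.surj (j ≫ b) hd hc c₁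
  -- every point over `s` is the value at `δ` of a morphism out of the connected object `d`
  have key (W : C) (hW : W ∈ s) (p : F.obj W) : ∃ φ : d ⟶ W, F.map φ δ = p := by
    obtain ⟨r, hr⟩ := hT ⟨W, p⟩ hW
    exact ⟨j ≫ a ≫ r, by simp [hδ, ha, hr]⟩
  choose φ hφ using key
  refine ⟨fun W p ↦ if hW : W ∈ s then F.map (φ W hW p) δ' else p, ?_, ?_, ?_⟩
  · intro W hW p q hpq
    simp only [dif_pos hW] at hpq
    rw [← hφ W hW p, ← hφ W hW q, hF.rigid _ _ δ' hd hpq]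
  · intro W hW W' hW' f p
    simp only [dif_pos hW, dif_pos hW']
    rw [← hF.rigid (φ W hW p ≫ f) (φ W' hW' (F.map f p)) δ hd (by simp [hφ])]
    simp
  · intro Z' hZ' hs p
    simp only [dif_pos hs]
    obtain ⟨r, hr⟩ := hz ⟨Z', p⟩ hZ'
    replace hr : F.map (P.map r) z = p := hr
    rw [hF.rigid (φ _ hs p) ((j ≫ b) ≫ i ≫ P.map r) δ hd
      (by simp only [hφ, Functor.map_comp, comp_apply, hδ, hb, h₀, hr])]
    have := NatTrans.naturality_apply g.hom r z
    simp only [Functor.map_comp, comp_apply] at hδ' ⊢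
    rw [hδ', h₁, ← hr]
    exact this.symm

/-- The image of `Aut F` in `Aut (P ⋙ F)` contains every automorphism that moves each point to a
joined point. As the values of `F` are finite, the permutations found over finitely many objects
converge along an ultrafilter. -/
lemma HasConnectedPoints.exists_mapAut_eq (hF : HasConnectedPoints F conn)
    (hP : HasDominatingPoints (P ⋙ F)) (g : Aut (P ⋙ F))
    (hg : ∀ (Z : D) (z : (P ⋙ F).obj Z), JoinedPoints F conn (T := P.obj Z) z (g.hom.app Z z)) :
    ∃ γ : Aut F, ((Functor.whiskeringLeft _ _ (Type w)).obj P).mapAut F γ = g := by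
  classical
  have := hF.finite
  choose γ hinj hnat hγ using hF.exists_partial hP g hg
  let U : Ultrafilter (Finset C × Finset D) := Ultrafilter.of Filter.atTop
  have hU (s : Finset C) (t : Finset D) :
      ∀ᶠ i in (U : Filter (Finset C × Finset D)), s ⊆ i.1 ∧ t ⊆ i.2 :=
    (Ultrafilter.of_le _) (Filter.eventually_ge_atTop (s, t))
  have hlim (W : C) (p : F.obj W) :
      ∃ v, ∀ᶠ i in (U : Filter (Finset C × Finset D)), γ i.1 i.2 W p = v := by
    by_contra! h
    have h' : ∀ v, ∀ᶠ i in (U : Filter (Finset C × Finset D)), γ i.1 i.2 W p ≠ v := fun v ↦ by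
      simpa using h v
    obtain ⟨i, hi⟩ := (Filter.eventually_all.mpr h').exists
    exact hi _ rfl
  choose δ hδ using hlim
  have δnat {W W' : C} (φ : W ⟶ W') (p : F.obj W) : F.map φ (δ W p) = δ W' (F.map φ p) := by
    obtain ⟨i, ⟨hi, -⟩, h₁, h₂⟩ :=
      ((hU {W, W'} ∅).and ((hδ W p).and (hδ W' (F.map φ p)))).exists
    rw [← h₁, ← h₂]
    exact hnat _ _ W (hi (by simp)) W' (hi (by simp)) φ p
  have δinj (W : C) : Function.Injective (δ W) := by
    intro p q h
    obtain ⟨i, ⟨hi, -⟩, h₁, h₂⟩ := ((hU {W} ∅).and ((hδ W p).and (hδ W q))).exists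
    exact hinj _ _ W (hi (by simp)) (h₁.trans (h.trans h₂.symm))
  refine ⟨NatIso.ofComponents
    (fun W ↦ (Equiv.ofBijective (δ W) (Finite.injective_iff_bijective.mp (δinj W))).toIso)
    (fun φ ↦ by ext p; exact (δnat φ p).symm), ?_⟩
  ext Z p
  obtain ⟨i, ⟨hi, hi'⟩, h₁⟩ := ((hU {P.obj Z} {Z}).and (hδ (P.obj Z) p)).exists
  exact h₁.symm.trans (hγ _ _ Z (hi' (by simp)) (hi (by simp)) p)

/-- The criterion for finite index: among any `n + 1` translates of a point by automorphisms of
`P ⋙ F`, two are joined. If the image of `Aut F` had more than `n` cosets, then finitely many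
points of `P ⋙ F` would witness that, and a point dominating suitable translates of these would
violate the criterion. -/
theorem HasConnectedPoints.finiteIndex_range (hF : HasConnectedPoints F conn)
    (hP : HasDominatingPoints (P ⋙ F)) (n : ℕ)
    (hn : ∀ (Z : D) (z : (P ⋙ F).obj Z) (g : Fin (n + 1) → Aut (P ⋙ F)), ∃ i j, i ≠ j ∧
      JoinedPoints F conn (T := P.obj Z) ((g i).hom.app Z z) ((g j).hom.app Z z)) :
    (((Functor.whiskeringLeft _ _ (Type w)).obj P).mapAut F).range.FiniteIndex := by
  classical
  set H := (((Functor.whiskeringLeft _ _ (Type w)).obj P).mapAut F).range with hH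
  suffices Finite (Aut (P ⋙ F) ⧸ H) from Subgroup.finiteIndex_of_finite_quotient
  by_contra hinf
  rw [not_finite_iff_infinite] at hinf
  obtain ⟨e⟩ : Nonempty (Fin (n + 1) ↪ Aut (P ⋙ F) ⧸ H) :=
    ⟨Fin.valEmbedding.trans (Infinite.natEmbedding _)⟩
  -- inverses, because the quotient consists of left cosets and `g i * (g j)⁻¹` is needed below
  let g (i : Fin (n + 1)) : Aut (P ⋙ F) := (e i).out⁻¹
  have hg (i j : Fin (n + 1)) (hij : i ≠ j) : g i * (g j)⁻¹ ∉ H := by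
    intro h
    apply hij
    apply e.injective
    rw [← QuotientGroup.out_eq' (e i), ← QuotientGroup.out_eq' (e j), QuotientGroup.eq]
    simpa [g] using h
  have hex (i j : Fin (n + 1)) : ∃ (Z : D) (z : (P ⋙ F).obj Z), i ≠ j →
      ¬ JoinedPoints F conn (T := P.obj Z) z ((g i * (g j)⁻¹).hom.app Z z) := by
    by_cases hij : i = j
    · obtain ⟨Z, ⟨z⟩⟩ := hP.exists_point
      exact ⟨Z, z, fun h ↦ (h hij).elim⟩
    · by_contra! h
      exact hg i j hij (hF.exists_mapAut_eq hP _ fun Z z ↦ (h Z z).2)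
  choose Z z hz using hex
  obtain ⟨T, t, ht⟩ := hP.exists_dominating_of_finite
    (Set.finite_range fun ij : Fin (n + 1) × Fin (n + 1) ↦
      (⟨Z ij.1 ij.2, (g ij.2).inv.app _ (z ij.1 ij.2)⟩ : Σ W, (P ⋙ F).obj W))
  -- `t` dominates the points `(g j)⁻¹ (z i j)`, so if `g i t` and `g j t` were joined, then
  -- `g j ((g i)⁻¹ (z j i))` and `z j i` would be, against the choice of `z j i`
  obtain ⟨i, j, hij, hJ⟩ := hn T t g
  obtain ⟨p, hp⟩ : ∃ p : T ⟶ Z j i, F.map (P.map p) t = (g i).inv.app (Z j i) (z j i) :=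
    ht ⟨Z j i, _⟩ ⟨(j, i), rfl⟩
  refine hz j i hij.symm ?_
  have h (k : Fin (n + 1)) : F.map (P.map p) ((g k).hom.app T t) =
      (g k).hom.app _ ((g i).inv.app _ (z j i)) :=
    (NatTrans.naturality_apply (Iso.hom (g k)) p t).symm.trans
      (congrArg ((Iso.hom (g k)).app _) hp)
  have hi : (g i).hom.app _ ((g i).inv.app _ (z j i)) = z j i :=
    congr($(Iso.inv_hom_id (g i)).app (Z j i) (z j i))
  have := hJ.map (P.map p)
  rwa [h, h, hi] at this

end FibreFunctor

/-! ### Points of `E ⊗[K] L` for a finitely generated extension `L / K` -/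

section TensorProduct

open TensorProduct

lemma PrimeSpectrum.finite_and_card_le_finrank (k R : Type*) [Field k] [CommRing R] [Algebra k R]
    [Module.Finite k R] :
    Finite (PrimeSpectrum R) ∧ Nat.card (PrimeSpectrum R) ≤ Module.finrank k R := by
  have : IsArtinianRing R := isArtinian_of_tower k inferInstance
  have : Finite (PrimeSpectrum R) := inferInstance
  refine ⟨this, ?_⟩
  have := Fintype.ofFinite (PrimeSpectrum R)
  rw [IsArtinianRing.finrank_eq_sum_primeSpectrum (R := R) k, Nat.card_eq_fintype_card,
    Fintype.card_eq_sum_ones]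
  refine Finset.sum_le_sum fun p _ ↦ ?_
  have : Module.Finite k (Localization.AtPrime p.asIdeal) :=
    Module.Finite.of_surjective (Algebra.algHom k R (Localization.AtPrime p.asIdeal)).toLinearMap
      (IsArtinianRing.localization_surjective p.asIdeal.primeCompl _)
  exact Module.finrank_pos

lemma IsFractionRing.isDomain_tensorProduct (K A F E : Type*) [Field K] [CommRing A] [IsDomain A]
    [Algebra K A] [Field F] [Algebra K F] [Algebra A F] [IsScalarTower K A F] [IsFractionRing A F]
    [Field E] [Algebra K E] [IsDomain (A ⊗[K] E)] : IsDomain (F ⊗[K] E) := by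
  let φ : A ⊗[K] E →ₐ[K] F ⊗[K] E :=
    Algebra.TensorProduct.map (Algebra.algHom K A F) (AlgHom.id K E)
  let : Algebra (A ⊗[K] E) (F ⊗[K] E) := φ.toAlgebra
  have : IsScalarTower A (A ⊗[K] E) (F ⊗[K] E) := .of_algebraMap_eq fun a ↦ by
    simp [RingHom.algebraMap_toAlgebra, Algebra.TensorProduct.algebraMap_apply, φ]
    rfl
  have := IsLocalization.tensorProduct_tensorProduct K E (nonZeroDivisors A) F (by
    ext; simp [RingHom.algebraMap_toAlgebra, φ])
  refine IsLocalization.isDomain_of_le_nonZeroDivisors (F ⊗[K] E)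
    (M := Algebra.algebraMapSubmonoid (A ⊗[K] E) (nonZeroDivisors A)) ?_
  refine map_le_nonZeroDivisors_of_injective _ ?_ le_rfl
  exact Algebra.TensorProduct.includeLeft_injective (R := K) (S := A) (A := A) (B := E)
    (algebraMap K E).injective

open scoped IntermediateField.algebraAdjoinAdjoin in
lemma AlgebraicIndependent.isDomain_adjoin_tensorProduct {K E L ι : Type*} [Field K] [Field E]
    [Field L] [Algebra K E] [Algebra K L] {x : ι → L} (hx : AlgebraicIndependent K x) :
    IsDomain (IntermediateField.adjoin K (Set.range x) ⊗[K] E) := by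
  have e : Algebra.adjoin K (Set.range x) ⊗[K] E ≃ₐ[K] MvPolynomial ι E :=
    (Algebra.TensorProduct.comm K _ E).trans <|
    (Algebra.TensorProduct.congr AlgEquiv.refl hx.aevalEquiv.symm).trans
      ((MvPolynomial.algebraTensorAlgEquiv K E).restrictScalars K)
  have : IsDomain (Algebra.adjoin K (Set.range x) ⊗[K] E) := e.toMulEquiv.isDomain
  exact IsFractionRing.isDomain_tensorProduct K (Algebra.adjoin K (Set.range x)) _ E

lemma card_primeSpectrum_tensorProduct_le_finrank (K F L E : Type*) [Field K] [Field F] [Field L]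
    [Field E] [Algebra K F] [Algebra K L] [Algebra F L] [IsScalarTower K F L] [Algebra K E]
    [Module.Finite K E] [Module.Finite F L] [IsDomain (F ⊗[K] E)] :
    Finite (PrimeSpectrum (E ⊗[K] L)) ∧
      Nat.card (PrimeSpectrum (E ⊗[K] L)) ≤ Module.finrank F L := by
  let : Field (F ⊗[K] E) :=
    (Algebra.TensorProduct.isField_of_isAlgebraic K F E (Or.inr inferInstance)).toField
  let e : (F ⊗[K] E) ⊗[F] L ≃+* E ⊗[K] L :=
    (Algebra.TensorProduct.comm F (F ⊗[K] E) L).toRingEquiv.trans <|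
    (Algebra.TensorProduct.cancelBaseChange K F F L E).toRingEquiv.trans
      (Algebra.TensorProduct.comm K L E).toRingEquiv
  obtain ⟨h₁, h₂⟩ := PrimeSpectrum.finite_and_card_le_finrank (F ⊗[K] E) ((F ⊗[K] E) ⊗[F] L)
  rw [Module.finrank_baseChange] at h₂
  have e' := (PrimeSpectrum.homeomorphOfRingEquiv e).toEquiv
  exact ⟨.of_equiv _ e', (Nat.card_congr e'.symm).trans_le h₂⟩

/-- If `L / K` is a finitely generated field extension, then the number of points of
`Spec (E ⊗[K] L)` is bounded independently of the finite extension `E / K`: for a transcendence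
basis `x` of `L / K`, the ring `K(x) ⊗[K] E` is a field, and `E ⊗[K] L` is an algebra of degree
`[L : K(x)]` over it. -/
theorem exists_card_primeSpectrum_tensorProduct_le (K L : Type*) [Field K] [Field L] [Algebra K L]
    [Algebra.EssFiniteType K L] :
    ∃ n : ℕ, ∀ (E : Type u) [Field E] [Algebra K E] [Module.Finite K E],
      Finite (PrimeSpectrum (E ⊗[K] L)) ∧ Nat.card (PrimeSpectrum (E ⊗[K] L)) ≤ n := by
  obtain ⟨ι, x, hx⟩ := exists_isTranscendenceBasis' K L
  let F := IntermediateField.adjoin K (Set.range x)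
  have : Algebra.IsAlgebraic F L := hx.isAlgebraic_field
  have : Algebra.EssFiniteType F L := .of_comp K F L
  have : Module.Finite F L := Algebra.finite_of_essFiniteType_of_isAlgebraic
  refine ⟨Module.finrank F L, fun E _ _ _ ↦ ?_⟩
  have := hx.1.isDomain_adjoin_tensorProduct (E := E)
  exact card_primeSpectrum_tensorProduct_le_finrank K F L E

end TensorProduct

/-! ### Open and closed maps onto connected spaces -/

section Topology

variable {W X : Type*} [TopologicalSpace W] [TopologicalSpace X] {f : W → X}

lemma IsClopen.image_eq_univ [PreconnectedSpace X] (ho : IsOpenMap f) (hc : IsClosedMap f)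
    {s : Set W} (hs : IsClopen s) (hne : s.Nonempty) : f '' s = Set.univ :=
  IsClopen.eq_univ ⟨hc s hs.1, ho s hs.2⟩ (hne.image f)

/-- The connected component of `w` is the clopen neighbourhood of `w` that has the least number of
points in the fibre of `f w`. -/
lemma isOpen_connectedComponent_of_finite_fiber [PreconnectedSpace X] (ho : IsOpenMap f)
    (hc : IsClosedMap f) (w : W) (hfin : (f ⁻¹' {f w}).Finite) :
    IsOpen (connectedComponent w) := by
  let N (s : Set W) : ℕ := (s ∩ f ⁻¹' {f w}).ncard
  let S : Set (Set W) := {s | IsClopen s ∧ w ∈ s}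
  obtain ⟨s, ⟨hs, hws⟩, hmin⟩ : ∃ s ∈ S, ∀ t ∈ S, N s ≤ N t :=
    ⟨_, Function.argminOn_mem N S ⟨Set.univ, isClopen_univ, trivial⟩,
      fun t ht ↦ Function.argminOn_le N S ht⟩
  have key (a b : Set W) (ha : IsClosed a) (hb : IsClosed b) (hab : s ⊆ a ∪ b)
      (hd : Disjoint a b) (hwa : w ∈ a) : s ⊆ a := by
    have h₁ : s ∩ a = s ∩ bᶜ := by
      ext y
      have := @hab y
      have : y ∈ a → y ∉ b := fun h ↦ Set.disjoint_left.mp hd h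
      simp only [Set.mem_union, Set.mem_inter_iff, Set.mem_compl_iff] at *
      tauto
    have h₂ : s ∩ b = s ∩ aᶜ := by
      ext y
      have := @hab y
      have : y ∈ a → y ∉ b := fun h ↦ Set.disjoint_left.mp hd h
      simp only [Set.mem_union, Set.mem_inter_iff, Set.mem_compl_iff] at *
      tauto
    have hsa : IsClopen (s ∩ a) := ⟨hs.1.inter ha, h₁ ▸ hs.2.inter hb.isOpen_compl⟩
    have hsb : IsClopen (s ∩ b) := ⟨hs.1.inter hb, h₂ ▸ hs.2.inter ha.isOpen_compl⟩
    by_contra hsa'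
    obtain ⟨y, hys, hya⟩ := Set.not_subset.mp hsa'
    obtain ⟨z, ⟨hzs, hzb⟩, hz⟩ : f w ∈ f '' (s ∩ b) := by
      rw [hsb.image_eq_univ ho hc ⟨y, hys, (hab hys).resolve_left hya⟩]
      trivial
    refine (hmin (s ∩ a) ⟨hsa, hws, hwa⟩).not_gt (Set.ncard_lt_ncard ?_ (hfin.inter_of_right _))
    refine ⟨by gcongr; exact Set.inter_subset_left, fun h ↦ ?_⟩
    exact Set.disjoint_left.mp hd (h ⟨hzs, hz⟩).1.2 hzb
  have hpre : IsPreconnected s := by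
    rw [isPreconnected_iff_subset_of_fully_disjoint_closed hs.1]
    intro a b ha hb hab hd
    obtain hw | hw := hab hws
    · exact .inl (key a b ha hb hab hd hw)
    · exact .inr (key b a hb ha (Set.union_comm a b ▸ hab) hd.symm hw)
  rw [(hpre.subset_connectedComponent hws).antisymm' (hs.connectedComponent_subset hws)]
  exact hs.2

end Topology

/-! ### Geometric points of finite étale coverings -/

namespace EtaleFundamentalGroup

open Limits

variable {W X : Scheme.{u}} (f : W ⟶ X)

lemma isOpen_connectedComponent [IsFinite f] [Etale f] [PreconnectedSpace X] (w : W) :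
    IsOpen (connectedComponent w) :=
  isOpen_connectedComponent_of_finite_fiber f.isOpenMap f.isClosedMap w
    (f.finite_preimage_singleton _)

/-- Over a connected base, a nonempty finite étale covering has a point over every geometric
point. -/
lemma exists_geometricPoint [IsFinite f] [Etale f] [PreconnectedSpace X] [Nonempty W]
    {Ω : Type u} [Field Ω] [IsSepClosed Ω] (x : Spec (.of Ω) ⟶ X) :
    ∃ l : Spec (.of Ω) ⟶ W, l ≫ f = x := by
  obtain ⟨w, -, hw⟩ : x default ∈ f '' Set.univ := by
    rw [isClopen_univ.image_eq_univ f.isOpenMap f.isClosedMap Set.univ_nonempty]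
    trivial
  obtain ⟨l, hl, -⟩ := Scheme.exists_fac_of_etale_of_isSepClosed f x w hw
  exact ⟨l, hl⟩

lemma finite_geometricPoints [IsFinite f] {Ω : Type u} [Field Ω] (x : Spec (.of Ω) ⟶ X) :
    Finite {l : Spec (.of Ω) ⟶ W // l ≫ f = x} := by
  let B := Γ(pullback f x, ⊤)
  have : IsAffine (pullback f x) := isAffine_of_isAffineHom (pullback.snd f x)
  let φ : CommRingCat.of Ω ⟶ B := (Scheme.ΓSpecIso _).inv ≫ (pullback.snd f x).appTop
  let : Algebra Ω B := φ.hom.toAlgebra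
  have : Module.Finite Ω B := by
    have h₁ : φ.hom.Finite := by
      rw [CommRingCat.hom_comp]
      exact RingHom.Finite.comp ((pullback.snd f x).finite_appTop)
        (RingHom.Finite.of_surjective _ (ConcreteCategory.bijective_of_isIso
          (Scheme.ΓSpecIso (CommRingCat.of Ω)).inv).2)
    exact h₁
  let s (l : {l : Spec (.of Ω) ⟶ W // l ≫ f = x}) : Spec (.of Ω) ⟶ pullback f x :=
    pullback.lift l.1 (𝟙 _) (by simpa using l.2)
  let ψ (l : {l : Spec (.of Ω) ⟶ W // l ≫ f = x}) : B →ₐ[Ω] Ω :=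
    { toRingHom := ((s l).appTop ≫ (Scheme.ΓSpecIso (.of Ω)).hom).hom
      commutes' a := by
        have : φ ≫ (s l).appTop ≫ (Scheme.ΓSpecIso (.of Ω)).hom = 𝟙 _ := by
          simp only [φ, Category.assoc, ← Scheme.Hom.comp_appTop_assoc, s, pullback.lift_snd]
          simp
        exact congr($this a) }
  refine Finite.of_injective ψ fun l l' h ↦ ?_
  have h₁ : (s l).appTop ≫ (Scheme.ΓSpecIso (.of Ω)).hom =
      (s l').appTop ≫ (Scheme.ΓSpecIso (.of Ω)).hom := by
    ext b
    exact congr($h b)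
  have h₂ : s l = s l' := ext_of_isAffine (by simpa using h₁)
  ext1
  calc l.1 = s l ≫ pullback.fst f x := (pullback.lift_fst _ _ _).symm
    _ = s l' ≫ pullback.fst f x := by rw [h₂]
    _ = l'.1 := pullback.lift_fst _ _ _

/-- Two morphisms from a connected scheme to a separated unramified `X`-scheme agree if they agree
at one geometric point, because the locus where they agree is open and closed. -/
lemma hom_ext_of_geometricPoint [IsSeparated f] [Etale f] {D : Scheme.{u}}
    [PreconnectedSpace D] (h h' : D ⟶ W) (hf : h ≫ f = h' ≫ f) {T : Scheme.{u}} [Nonempty T]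
    (t : T ⟶ D) (ht : t ≫ h = t ≫ h') : h = h' := by
  let p := pullback.fst (pullback.lift h h' hf) (pullback.diagonal f)
  have : IsOpenImmersion p := MorphismProperty.pullback_fst _ _ inferInstance
  have : IsClosedImmersion p := inferInstance
  have hp : p ≫ h = p ≫ h' := by
    have := pullback.condition (f := pullback.lift h h' hf) (g := pullback.diagonal f)
    have h₁ := congr($this ≫ pullback.fst f f)
    have h₂ := congr($this ≫ pullback.snd f f)
    simp only [Category.assoc, pullback.lift_fst, pullback.lift_snd, pullback.diagonal_fst,
      pullback.diagonal_snd] at h₁ h₂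
    exact h₁.trans h₂.symm
  let r : T ⟶ pullback (pullback.lift h h' hf) (pullback.diagonal f) :=
    pullback.lift t (t ≫ h) <| by
      apply pullback.hom_ext
      · rw [Category.assoc, pullback.lift_fst, Category.assoc, pullback.diagonal_fst,
          Category.comp_id]
      · rw [Category.assoc, pullback.lift_snd, Category.assoc, pullback.diagonal_snd,
          Category.comp_id, ht]
  have : Surjective p := by
    refine ⟨Set.range_eq_univ.mp (IsClopen.eq_univ
      ⟨p.isClosedMap.isClosed_range, p.isOpenMap.isOpen_range⟩ ?_)⟩
    exact ⟨_, r (Classical.arbitrary T), rfl⟩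
  have : IsIso p := (isIso_iff_isOpenImmersion_and_surjective p).mpr ⟨inferInstance, inferInstance⟩
  exact (cancel_epi p).mp hp

end EtaleFundamentalGroup

/-! ### The fibre functor at a geometric point -/

namespace EtaleFundamentalGroup

open Limits

variable {X : Scheme.{u}}

instance (W : FEt X) : IsFinite W.hom := W.prop.1

instance (W : FEt X) : Etale W.hom := W.prop.2

instance {W W' : FEt X} (h : W ⟶ W') : IsFinite h.left := by
  have : IsFinite (h.left ≫ W'.hom) := by rw [MorphismProperty.Over.w]; infer_instance
  exact .of_comp h.left W'.hom

instance {W W' : FEt X} (h : W ⟶ W') : Etale h.left := by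
  have : Etale (h.left ≫ W'.hom) := by rw [MorphismProperty.Over.w]; infer_instance
  exact .of_comp h.left W'.hom

variable {Ω : Type u} [Field Ω] (x : Spec (.of Ω) ⟶ X)

/-- A point of the fibre functor, as a morphism of schemes. -/
noncomputable abbrev pointHom {W : FEt X} (p : (fiberFunctor x).obj W) : Spec (.of Ω) ⟶ W.left :=
  Over.Hom.left p

/-- The element of the fibre at `x` given by a morphism of schemes above `x`. -/
noncomputable def mkPoint {W : FEt X} (l : Spec (.of Ω) ⟶ W.left) (hl : l ≫ W.hom = x) :
    (fiberFunctor x).obj W :=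
  Over.homMk (U := Over.mk x) (V := W.toComma) l hl

variable {x}

lemma pointHom_comp_hom {W : FEt X} (p : (fiberFunctor x).obj W) : pointHom x p ≫ W.hom = x :=
  Over.w (p : Over.mk x ⟶ W.toComma)

lemma point_ext {W : FEt X} {p q : (fiberFunctor x).obj W} (h : pointHom x p = pointHom x q) :
    p = q :=
  Over.OverMorphism.ext h

variable (x) in
lemma hasDominatingPoints_fiberFunctor : HasDominatingPoints (fiberFunctor x) where
  exists_point := ⟨MorphismProperty.Over.mk ⊤ (𝟙 X) ⟨inferInstance, inferInstance⟩,
    ⟨mkPoint x x (Category.comp_id x)⟩⟩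
  exists_dominating W W' w w' := by
    let T : FEt X := MorphismProperty.Over.mk ⊤ (pullback.fst W.hom W'.hom ≫ W.hom)
      ⟨inferInstance, inferInstance⟩
    let l : Spec (.of Ω) ⟶ T.left := pullback.lift (pointHom x w) (pointHom x w')
      (by simp only [pointHom_comp_hom])
    have hl : l ≫ pullback.fst W.hom W'.hom = pointHom x w := pullback.lift_fst _ _ _
    have hl' : l ≫ pullback.snd W.hom W'.hom = pointHom x w' := pullback.lift_snd _ _ _
    refine ⟨T, mkPoint x l ((Category.assoc _ _ _).symm.trans (by rw [hl, pointHom_comp_hom])),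
      MorphismProperty.Over.homMk (pullback.fst W.hom W'.hom) rfl,
      MorphismProperty.Over.homMk (pullback.snd W.hom W'.hom) pullback.condition.symm,
      point_ext hl, point_ext hl'⟩

/-- The connected component of a point `w` of a finite étale covering, as a covering. -/
noncomputable def componentCover [PreconnectedSpace X] (W : FEt X) (w : W.left) : FEt X :=
  let U : W.left.Opens := ⟨connectedComponent w, isOpen_connectedComponent (X := X) W.hom w⟩
  have : IsClosedImmersion U.ι := .of_isPreimmersion _ (by
    simpa [U] using isClosed_connectedComponent)
  MorphismProperty.Over.mk ⊤ (U.ι ≫ W.hom) ⟨inferInstance, inferInstance⟩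

/-- The inclusion of a connected component. -/
noncomputable def componentCoverι [PreconnectedSpace X] (W : FEt X) (w : W.left) :
    componentCover W w ⟶ W :=
  MorphismProperty.Over.homMk
    (Scheme.Opens.ι ⟨connectedComponent w, isOpen_connectedComponent (X := X) W.hom w⟩) rfl

instance [PreconnectedSpace X] (W : FEt X) (w : W.left) :
    ConnectedSpace (componentCover W w).left :=
  isConnected_iff_connectedSpace.mp isConnected_connectedComponent

lemma exists_map_componentCoverι [PreconnectedSpace X] (W : FEt X) (w : W.left)
    (p : (fiberFunctor x).obj W) (hp : pointHom x p default ∈ connectedComponent w) :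
    ∃ q, (fiberFunctor x).map (componentCoverι W w) q = p := by
  let U : W.left.Opens := ⟨connectedComponent w, isOpen_connectedComponent (X := X) W.hom w⟩
  let l : Spec (.of Ω) ⟶ U := IsOpenImmersion.lift U.ι (pointHom x p) (by
    rintro _ ⟨y, rfl⟩
    rw [Subsingleton.elim y default]
    simpa [U] using hp)
  have hl : l ≫ U.ι = pointHom x p := IsOpenImmersion.lift_fac _ _ _
  refine ⟨mkPoint x l ?_, point_ext hl⟩
  exact (Category.assoc _ _ _).symm.trans (congr($hl ≫ W.hom).trans (pointHom_comp_hom p))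

/-- Geometric points of the same connected component are joined. -/
lemma joinedPoints_of_mem_connectedComponent [PreconnectedSpace X] {W : FEt X}
    {p q : (fiberFunctor x).obj W}
    (h : pointHom x q default ∈ connectedComponent (pointHom x p default)) :
    JoinedPoints (fiberFunctor x) (fun W ↦ ConnectedSpace W.left) p q := by
  obtain ⟨p', hp⟩ := exists_map_componentCoverι W _ p mem_connectedComponent
  obtain ⟨q', hq⟩ := exists_map_componentCoverι W _ q h
  exact ⟨_, _, p', q', inferInstance, hp, hq⟩

variable (x) in
lemma hasConnectedPoints_fiberFunctor [PreconnectedSpace X] [IsSepClosed Ω] :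
    HasConnectedPoints (fiberFunctor x) (fun W ↦ ConnectedSpace W.left) where
  __ := hasDominatingPoints_fiberFunctor x
  finite W := by
    have : Finite {l : Spec (.of Ω) ⟶ W.left // l ≫ W.hom = x} :=
      finite_geometricPoints (X := X) W.hom x
    exact .of_injective
      (fun p : (fiberFunctor x).obj W ↦
        (⟨pointHom x p, pointHom_comp_hom p⟩ : {l : Spec (.of Ω) ⟶ W.left // l ≫ W.hom = x}))
      fun p q h ↦ point_ext congr($h.1)
  exists_conn W p := by
    obtain ⟨q, hq⟩ := exists_map_componentCoverι W _ p mem_connectedComponent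
    exact ⟨_, _, q, inferInstance, hq⟩
  rigid {c W} h h' s hc hs := by
    have := hc.toPreconnectedSpace
    refine MorphismProperty.Over.Hom.ext (hom_ext_of_geometricPoint (X := X) W.hom h.left h'.left ?_
      (pointHom x s) congr(pointHom x $hs))
    rw [MorphismProperty.Over.w, MorphismProperty.Over.w]
  surj {c c'} h hc hc' p := by
    obtain ⟨l, hl⟩ := exists_geometricPoint h.left (pointHom x p)
    refine ⟨mkPoint x l ?_, point_ext hl⟩
    rw [← MorphismProperty.Over.w h, reassoc_of% hl, pointHom_comp_hom]

end EtaleFundamentalGroup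

/-! ### Finite étale coverings of a normal scheme and their generic fibres -/

namespace EtaleFundamentalGroup

open Limits

variable {Y : Scheme.{u}}

lemma IsNormalScheme.isIntegrallyClosed [IsIntegral Y] (hY : IsNormalScheme Y) {V : Y.Opens}
    (hV : IsAffineOpen V) [Nonempty V] : IsIntegrallyClosed Γ(Y, V) := by
  let (p : PrimeSpectrum Γ(Y, V)) : Algebra Γ(Y, V) (Y.presheaf.stalk (hV.fromSpec p)) :=
    TopCat.Presheaf.algebra_section_stalk Y.presheaf ⟨_, (hV.isoSpec.inv p).2⟩
  have (P : Ideal Γ(Y, V)) [P.IsPrime] :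
      IsLocalization.AtPrime (Y.presheaf.stalk (hV.fromSpec ⟨P, inferInstance⟩)) P :=
    hV.isLocalization_stalk' ⟨P, inferInstance⟩ (hV.isoSpec.inv _).2
  exact IsIntegrallyClosed.of_isLocalization_maximal
    (fun P _ ↦ Y.presheaf.stalk (hV.fromSpec ⟨P, inferInstance⟩)) fun P _ ↦ (hY _).2

instance quasiCompact_fromSpecStalk_genericPoint [IsIntegral Y] :
    QuasiCompact (Y.fromSpecStalk (genericPoint Y)) := by
  have : Subsingleton (Spec (Y.presheaf.stalk (genericPoint Y))) :=
    inferInstanceAs (Subsingleton (PrimeSpectrum Y.functionField))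
  exact ⟨fun U _ _ ↦ (Set.subsingleton_of_subsingleton).isCompact⟩

instance quasiSeparated_fromSpecStalk (y : Y) : QuasiSeparated (Y.fromSpecStalk y) := by
  have : IsSeparated (Y.fromSpecStalk y) := by
    have : IsSeparated (Y.fromSpecStalk y ≫ terminal.from _) := inferInstance
    exact .of_comp _ (terminal.from Y)
  infer_instance

lemma bijective_algebraMap_integralClosure {A K T : Type*} [CommRing A] [IsDomain A] [Field K]
    [CommRing T] [Algebra A K] [IsFractionRing A K] [IsIntegrallyClosed A] [Algebra A T]
    (e : K ≃ₐ[A] T) : Function.Bijective (algebraMap A (integralClosure A T)) := by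
  have he (a : A) : algebraMap A T a = e (algebraMap A K a) := (e.commutes a).symm
  refine ⟨fun a b h ↦ IsFractionRing.injective A K (e.injective ?_), fun ⟨z, hz⟩ ↦ ?_⟩
  · rw [← he, ← he]
    exact congr(($h).1)
  · obtain ⟨k, rfl⟩ := e.surjective z
    obtain ⟨a, rfl⟩ := IsIntegrallyClosed.isIntegral_iff.mp
      ((isIntegral_algEquiv e).mp hz)
    exact ⟨a, Subtype.ext (he a)⟩

/-- A normal integral scheme is its own normalization in its function field. -/
lemma IsNormalScheme.isIso_fromNormalization [IsIntegral Y] (hY : IsNormalScheme Y) :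
    IsIso (Y.fromSpecStalk (genericPoint Y)).fromNormalization := by
  set j := Y.fromSpecStalk (genericPoint Y)
  refine IsZariskiLocalAtTarget.of_forall_exists_morphismRestrict (P := .isomorphisms _) fun y ↦ ?_
  obtain ⟨_, ⟨V, hV, rfl⟩, hyV, -⟩ := Y.isBasis_affineOpens.exists_subset_of_mem_open
    (Set.mem_univ y) isOpen_univ
  refine ⟨V, hyV, (isIso_morphismRestrict_iff_isIso_app _ hV).mpr ?_⟩
  have : Nonempty V := ⟨⟨y, hyV⟩⟩
  have := hY.isIntegrallyClosed hV
  have := functionField_isFractionRing_of_isAffineOpen Y V hV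
  have hη : genericPoint Y ∈ V :=
    ((genericPoint_spec Y).mem_open_set_iff V.isOpen).mpr ⟨y, trivial, hyV⟩
  have htop : j ⁻¹ᵁ V = ⊤ := by
    have : Subsingleton (Spec (Y.presheaf.stalk (genericPoint Y))) :=
      inferInstanceAs (Subsingleton (PrimeSpectrum Y.functionField))
    ext z
    rw [Subsingleton.elim z (IsLocalRing.closedPoint (Y.presheaf.stalk (genericPoint Y)))]
    refine iff_of_true ?_ trivial
    change j _ ∈ V
    rwa [Scheme.fromSpecStalk_closedPoint]
  let ρ := (Scheme.ΓSpecIso (Y.presheaf.stalk (genericPoint Y))).inv ≫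
    (Spec (Y.presheaf.stalk (genericPoint Y))).presheaf.map (homOfLE (le_top (a := j ⁻¹ᵁ V))).op
  have hρ : IsIso ρ := by
    have : IsIso (homOfLE (le_top (a := j ⁻¹ᵁ V))) := ⟨homOfLE htop.ge, rfl, rfl⟩
    infer_instance
  have hj : j.app V = Y.germToFunctionField V ≫ ρ := Scheme.fromSpecStalk_app hη
  rw [Scheme.Hom.fromNormalization_app _ hV]
  let := (j.app V).hom.toAlgebra
  let e : Y.functionField ≃ₐ[Γ(Y, V)] Γ(Spec (Y.presheaf.stalk (genericPoint Y)), j ⁻¹ᵁ V) :=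
    { toRingEquiv := (asIso ρ).commRingCatIsoToRingEquiv
      commutes' a := congr($hj.symm a) }
  have := (ConcreteCategory.isIso_iff_bijective (CommRingCat.ofHom (algebraMap Γ(Y, V)
    (integralClosure Γ(Y, V) Γ(Spec (Y.presheaf.stalk (genericPoint Y)), j ⁻¹ᵁ V))))).mpr
    (bijective_algebraMap_integralClosure e)
  exact IsIso.comp_isIso

/-- If `Z` is its own normalization in `A`, then every decomposition of `A` into two disjoint open
subsets extends to `Z`: it is a morphism from `A` to the integral `Z`-scheme `Z ⨿ Z`, which
extends to a section over `Z`. -/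
lemma preconnectedSpace_of_isIso_fromNormalization {A Z : Scheme.{u}} (h : A ⟶ Z) [QuasiCompact h]
    [QuasiSeparated h] [IsIso h.fromNormalization] [PreconnectedSpace Z] :
    PreconnectedSpace A := by
  rw [preconnectedSpace_iff_clopen]
  intro S hS
  let U : A.Opens := ⟨S, hS.2⟩
  let V : A.Opens := ⟨Sᶜ, hS.1.isOpen_compl⟩
  have hUV : IsCompl U V := by
    rw [isCompl_iff, disjoint_iff, codisjoint_iff, ← TopologicalSpace.Opens.coe_inj,
      ← TopologicalSpace.Opens.coe_inj]
    exact ⟨Set.inter_compl_self S, Set.union_compl_self S⟩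
  obtain ⟨H⟩ := nonempty_isColimit_binaryCofanMk_of_isCompl U.ι V.ι (by simpa)
  let f₁ : A ⟶ Z ⨿ Z := H.desc (BinaryCofan.mk (U.ι ≫ h ≫ coprod.inl) (V.ι ≫ h ≫ coprod.inr))
  have h₁ : U.ι ≫ f₁ = U.ι ≫ h ≫ coprod.inl := H.fac _ ⟨.left⟩
  have h₂ : V.ι ≫ f₁ = V.ι ≫ h ≫ coprod.inr := H.fac _ ⟨.right⟩
  let f₂ : Z ⨿ Z ⟶ Z := coprod.desc (𝟙 Z) (𝟙 Z)
  have hf : h = f₁ ≫ f₂ := by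
    refine BinaryCofan.IsColimit.hom_ext H ?_ ?_
    · calc U.ι ≫ h = (U.ι ≫ h ≫ coprod.inl) ≫ f₂ := by
            rw [Category.assoc, Category.assoc, coprod.inl_desc, Category.comp_id]
        _ = U.ι ≫ f₁ ≫ f₂ := by rw [← h₁, Category.assoc]
    · calc V.ι ≫ h = (V.ι ≫ h ≫ coprod.inr) ≫ f₂ := by
            rw [Category.assoc, Category.assoc, coprod.inr_desc, Category.comp_id]
        _ = V.ι ≫ f₁ ≫ f₂ := by rw [← h₂, Category.assoc]
  let s : Z ⟶ Z ⨿ Z := inv h.fromNormalization ≫ h.normalizationDesc f₁ f₂ hf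
  have hs : h ≫ s = f₁ := by
    calc h ≫ s = (h.toNormalization ≫ h.fromNormalization) ≫ s := by
          rw [h.toNormalization_fromNormalization]
      _ = f₁ := by
          rw [Category.assoc, IsIso.hom_inv_id_assoc, h.toNormalization_normalizationDesc]
  have hc : IsClopen (s ⁻¹' Set.range (coprod.inl : Z ⟶ Z ⨿ Z)) := by
    refine IsClopen.preimage ⟨⟨?_⟩, (coprod.inl : Z ⟶ Z ⨿ Z).isOpenMap.isOpen_range⟩
      s.continuous
    rw [(isCompl_range_inl_inr Z Z).compl_eq]
    exact (coprod.inr : Z ⟶ Z ⨿ Z).isOpenMap.isOpen_range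
  have hS' : S = h ⁻¹' (s ⁻¹' Set.range (coprod.inl : Z ⟶ Z ⨿ Z)) := by
    ext a
    change a ∈ S ↔ s (h a) ∈ Set.range (coprod.inl : Z ⟶ Z ⨿ Z)
    rw [← Scheme.Hom.comp_apply, hs]
    constructor
    · intro ha
      exact ⟨h a, (congr($h₁ (⟨a, ha⟩ : U))).symm⟩
    · intro ha
      by_contra hn
      exact Set.disjoint_left.mp (isCompl_range_inl_inr Z Z).disjoint ha
        ⟨h a, (congr($h₂ (⟨a, hn⟩ : V))).symm⟩
  rw [hS']
  obtain h₀ | h₀ := isClopen_iff.mp hc <;> simp [h₀]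

/-- The generic fibre of a connected finite étale covering of a normal integral scheme is
connected: normalization commutes with étale base change, so the covering is its own normalization
in its generic fibre. -/
lemma IsNormalScheme.connectedSpace_genericFiber {Y Z : Scheme.{u}} [IsIntegral Y]
    (hY : IsNormalScheme Y) (g : Z ⟶ Y) [IsFinite g] [Etale g] [ConnectedSpace Z] (y : Y)
    (hy : y = genericPoint Y) : ConnectedSpace ↥(pullback (Y.fromSpecStalk y) g) := by
  subst hy
  have := hY.isIso_fromNormalization
  have : IsIso (pullback.snd (Y.fromSpecStalk (genericPoint Y)) g).fromNormalization := by
    rw [← Scheme.Hom.normalizationPullback_snd]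
    infer_instance
  have := preconnectedSpace_of_isIso_fromNormalization
    (pullback.snd (Y.fromSpecStalk (genericPoint Y)) g)
  have hne : Nonempty ↥(pullback (Y.fromSpecStalk (genericPoint Y)) g) := by
    obtain ⟨z, -, hz⟩ : genericPoint Y ∈ g '' Set.univ := by
      rw [isClopen_univ.image_eq_univ g.isOpenMap g.isClosedMap Set.univ_nonempty]
      trivial
    obtain ⟨a, -, -⟩ := Scheme.Pullback.exists_preimage_pullback
      (f := Y.fromSpecStalk (genericPoint Y)) (g := g)
      (IsLocalRing.closedPoint (Y.presheaf.stalk (genericPoint Y))) z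
      (by rw [Scheme.fromSpecStalk_closedPoint, hz])
    exact ⟨a⟩
  exact ⟨hne⟩

/-- A connected finite étale scheme over a field is the spectrum of a finite field extension. -/
lemma exists_iso_Spec_of_finite_etale_of_isField {K : CommRingCat.{u}} (hK : IsField K)
    {A : Scheme.{u}} (g : A ⟶ Spec K) [IsFinite g] [Etale g] [ConnectedSpace A] :
    ∃ (E : CommRingCat.{u}) (φ : K ⟶ E) (e : A ≅ Spec E), IsField E ∧ φ.hom.Finite ∧
      e.hom ≫ Spec.map φ = g := by
  have : IsAffine A := isAffine_of_isAffineHom g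
  let φ : K ⟶ Γ(A, ⊤) := (Scheme.ΓSpecIso K).inv ≫ g.appTop
  have hφ : A.isoSpec.hom ≫ Spec.map φ = g := by
    simp only [φ, Scheme.isoSpec_hom, Spec.map_comp, ← Scheme.toSpecΓ_naturality_assoc]
    simp
  have hφ' : A.isoSpec.inv ≫ g = Spec.map φ := by rw [← hφ, Iso.inv_hom_id_assoc]
  have h₁ : φ.hom.Finite := by
    rw [← IsFinite.SpecMap_iff, ← hφ']
    infer_instance
  have h₂ : φ.hom.Etale := by
    rw [← HasRingHomProperty.Spec_iff (P := @Etale), ← hφ']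
    infer_instance
  refine ⟨Γ(A, ⊤), φ, A.isoSpec, ?_, h₁, hφ⟩
  let := hK.toField
  algebraize [φ.hom]
  have : IsArtinianRing Γ(A, ⊤) := isArtinian_of_tower K inferInstance
  have : IsReduced Γ(A, ⊤) := Algebra.FormallyUnramified.isReduced_of_field K _
  have : ConnectedSpace (PrimeSpectrum Γ(A, ⊤)) :=
    (Scheme.homeoOfIso A.isoSpec).surjective.connectedSpace
      (Scheme.homeoOfIso A.isoSpec).continuous
  have : Nontrivial Γ(A, ⊤) := PrimeSpectrum.nonempty_iff_nontrivial.mp inferInstance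
  have : Subsingleton (PrimeSpectrum Γ(A, ⊤)) := PreconnectedSpace.trivial_of_discrete
  rw [← PrimeSpectrum.subsingleton_iff_isField_of_isReduced]
  infer_instance

/-- The number of points of the base change to `L` of a connected finite étale covering of `Spec K`
is bounded independently of the covering if `L / K` is a finitely generated field extension. -/
lemma exists_card_pullback_le {K L : CommRingCat.{u}} (hK : IsField K) (hL : IsField L) (ψ : K ⟶ L)
    (hψ : ψ.hom.EssFiniteType) :
    ∃ n : ℕ, ∀ (A : Scheme.{u}) (g : A ⟶ Spec K) [IsFinite g] [Etale g] [ConnectedSpace A],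
      Finite ↥(pullback g (Spec.map ψ)) ∧ Nat.card ↥(pullback g (Spec.map ψ)) ≤ n := by
  let := hK.toField
  let := hL.toField
  algebraize [ψ.hom]
  obtain ⟨n, hn⟩ := exists_card_primeSpectrum_tensorProduct_le.{u} K L
  refine ⟨n, fun A g _ _ _ ↦ ?_⟩
  obtain ⟨E, φ, e, hE, hφ, rfl⟩ := exists_iso_Spec_of_finite_etale_of_isField hK g
  let := hE.toField
  algebraize [φ.hom]
  obtain ⟨h₁, h₂⟩ := hn E
  have i : pullback (e.hom ≫ Spec.map φ) (Spec.map ψ) ≅ Spec (.of (TensorProduct K E L)) :=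
    asIso (pullback.map (e.hom ≫ Spec.map φ) (Spec.map ψ) (Spec.map φ) (Spec.map ψ) e.hom (𝟙 _)
      (𝟙 _) (by simp) (by simp)) ≪≫ pullbackSpecIso K E L
  have i' : ↥(pullback (e.hom ≫ Spec.map φ) (Spec.map ψ)) ≃ PrimeSpectrum (TensorProduct K E L) :=
    (Scheme.homeoOfIso i).toEquiv
  exact ⟨.of_equiv _ i'.symm, (Nat.card_congr i').trans_le h₂⟩

lemma apply_genericPoint_of_isDominant {X Y : Scheme.{u}} [IsIntegral X] [IsIntegral Y]
    (f : X ⟶ Y) [IsDominant f] : f (genericPoint X) = genericPoint Y := by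
  have := (genericPoint_spec X).image f.continuous
  rw [Set.image_univ, f.denseRange.closure_range] at this
  exact this.eq (genericPoint_spec Y)

/-- The points of `Z ×[Y] X` over the generic point of `X` are bounded in number, independently of
the connected finite étale covering `Z` of `Y`. -/
lemma exists_card_fiber_genericPoint_le {X Y : Scheme.{u}} [IsIntegral X] [IsIntegral Y]
    (hY : IsNormalScheme Y) (f : X ⟶ Y) [LocallyOfFiniteType f] [IsDominant f] :
    ∃ n : ℕ, ∀ (Z : Scheme.{u}) (g : Z ⟶ Y) [IsFinite g] [Etale g] [ConnectedSpace Z],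
      Finite (pullback.snd g f ⁻¹' {genericPoint X}) ∧
        Nat.card (pullback.snd g f ⁻¹' {genericPoint X}) ≤ n := by
  set η := genericPoint X with hη
  have hfη : f η = genericPoint Y := apply_genericPoint_of_isDominant f
  have hK : IsField (Y.presheaf.stalk (f η)) := by
    rw [hfη]
    exact Field.toIsField Y.functionField
  have hL : IsField (X.presheaf.stalk η) := Field.toIsField X.functionField
  obtain ⟨n, hn⟩ := exists_card_pullback_le hK hL (f.stalkMap η) (LocallyOfFiniteType.stalkMap f η)
  refine ⟨n, fun Z g _ _ _ ↦ ?_⟩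
  have := hY.connectedSpace_genericFiber g (f η) hfη
  obtain ⟨h₁, h₂⟩ := hn _ (pullback.fst (Y.fromSpecStalk (f η)) g)
  have e : pullback (pullback.snd g f) (X.fromSpecStalk η) ≅
      pullback (pullback.fst (Y.fromSpecStalk (f η)) g) (Spec.map (f.stalkMap η)) := by
    have p₁ := (IsPullback.of_hasPullback (pullback.snd g f) (X.fromSpecStalk η)).flip.paste_vert
      (IsPullback.of_hasPullback g f).flip
    have p₂ := (IsPullback.of_hasPullback (pullback.fst (Y.fromSpecStalk (f η)) g)
      (Spec.map (f.stalkMap η))).flip.paste_vert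
      (IsPullback.of_hasPullback (Y.fromSpecStalk (f η)) g)
    rw [Scheme.SpecMap_stalkMap_fromSpecStalk] at p₂
    exact p₁.isoIsPullback _ _ p₂
  have key (w : ↥(pullback.snd g f ⁻¹' {η})) :
      ∃ a, pullback.fst (pullback.snd g f) (X.fromSpecStalk η) a = w.1 := by
    obtain ⟨a, ha, -⟩ := Scheme.Pullback.exists_preimage_pullback
      (f := pullback.snd g f) (g := X.fromSpecStalk η) w.1
      (IsLocalRing.closedPoint (X.presheaf.stalk η))
      (by rw [Scheme.fromSpecStalk_closedPoint]; exact w.2)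
    exact ⟨a, ha⟩
  choose a ha using key
  have hinj : Function.Injective fun w ↦ e.hom (a w) := by
    intro w w' h
    have := (Scheme.homeoOfIso e).injective h
    exact Subtype.ext ((ha w).symm.trans (by rw [this, ha]))
  exact ⟨.of_injective _ hinj, (Nat.card_le_card_of_injective _ hinj).trans h₂⟩

end EtaleFundamentalGroup

/-! ### Finiteness of the index -/

namespace EtaleFundamentalGroup

open Limits

/-- If the fibre of a finite étale covering over the generic point has at most `n` points, then
among any `n + 1` points of the covering two lie in the same connected component, since every
connected component meets the generic fibre. -/
lemma exists_mem_connectedComponent {W X : Scheme.{u}} [IsIntegral X] (g : W ⟶ X) [IsFinite g]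
    [Etale g] (n : ℕ) (hfin : Finite (g ⁻¹' {genericPoint X}))
    (hn : Nat.card (g ⁻¹' {genericPoint X}) ≤ n) (w : Fin (n + 1) → W) :
    ∃ i j, i ≠ j ∧ w j ∈ connectedComponent (w i) := by
  by_contra! h
  have key (i : Fin (n + 1)) :
      ∃ a : ↥(g ⁻¹' {genericPoint X}), a.1 ∈ connectedComponent (w i) := by
    have hc : IsClopen (connectedComponent (w i)) :=
      ⟨isClosed_connectedComponent, isOpen_connectedComponent g _⟩
    obtain ⟨a, ha, ha'⟩ : genericPoint X ∈ g '' connectedComponent (w i) := by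
      rw [hc.image_eq_univ g.isOpenMap g.isClosedMap ⟨_, mem_connectedComponent⟩]
      trivial
    exact ⟨⟨a, ha'⟩, ha⟩
  choose a ha using key
  have hinj : Function.Injective a := by
    intro i j hij
    by_contra hne
    refine h i j hne ?_
    rw [connectedComponent_eq (ha i), hij, ← connectedComponent_eq (ha j)]
    exact mem_connectedComponent
  have := Nat.card_le_card_of_injective a hinj
  rw [Nat.card_eq_fintype_card, Fintype.card_fin] at this
  omega

variable {X Y : Scheme.{u}} [IsIntegral X] [IsIntegral Y]

/-- Among sufficiently many translates of a point of a covering of `Y` under automorphisms of the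
fibre functor, two lie in the same connected component of the base change to `X`. All translates
lie in one connected component `c` of the covering, and the number of components of `c ×[Y] X` is
bounded by the number of its points over the generic point of `X`. -/
lemma exists_joinedPoints (hY : IsNormalScheme Y) (f : X ⟶ Y) [LocallyOfFiniteType f]
    [IsDominant f] {Ω : Type u} [Field Ω] [IsSepClosed Ω] (x : Spec (.of Ω) ⟶ X) :
    ∃ n : ℕ, ∀ (Z : FEt Y) (z : (baseChange f ⋙ fiberFunctor x).obj Z)
      (g : Fin (n + 1) → Aut (baseChange f ⋙ fiberFunctor x)), ∃ i j, i ≠ j ∧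
        JoinedPoints (fiberFunctor x) (fun W ↦ ConnectedSpace W.left) (T := (baseChange f).obj Z)
          ((g i).hom.app Z z) ((g j).hom.app Z z) := by
  obtain ⟨n, hn⟩ := exists_card_fiber_genericPoint_le hY f
  refine ⟨n, fun Z z g ↦ ?_⟩
  let e := fiberBaseChangeIso f x
  obtain ⟨c, i, s, hc, hs⟩ :=
    (hasConnectedPoints_fiberFunctor (x ≫ f)).exists_conn Z (e.hom.app Z z)
  have hz : (baseChange f ⋙ fiberFunctor x).map i (e.inv.app c s) = z := by
    rw [← NatTrans.naturality_apply, hs, Iso.hom_inv_id_app_apply]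
  obtain ⟨h₁, h₂⟩ := hn c.left c.hom
  obtain ⟨k, l, hkl, h⟩ := exists_mem_connectedComponent (pullback.snd c.hom f) n h₁ h₂
    (fun k ↦ pointHom x (W := (baseChange f).obj c) ((g k).hom.app c (e.inv.app c s)) default)
  have := (joinedPoints_of_mem_connectedComponent h).map ((baseChange f).map i)
  have hg (k : Fin (n + 1)) : (fiberFunctor x).map ((baseChange f).map i)
      ((g k).hom.app c (e.inv.app c s)) = (g k).hom.app Z z := by
    rw [← hz]
    exact (NatTrans.naturality_apply (Iso.hom (g k)) i _).symm
  rw [hg, hg] at this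
  exact ⟨k, l, hkl, this⟩

end EtaleFundamentalGroup

theorem mainTheorem2 {X Y : Scheme.{u}} [IsIntegral X] [IsIntegral Y]
    (hX : EtaleFundamentalGroup.IsNormalScheme X) (hY : EtaleFundamentalGroup.IsNormalScheme Y)
    (f : X ⟶ Y) [LocallyOfFiniteType f] [IsDominant f]
    {Ω : Type u} [Field Ω] [IsSepClosed Ω] (x : Spec (.of Ω) ⟶ X) :
    (EtaleFundamentalGroup.pi1Map f x).range.FiniteIndex := by
  obtain ⟨n, hn⟩ := EtaleFundamentalGroup.exists_joinedPoints hY f x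
  have h := (EtaleFundamentalGroup.hasConnectedPoints_fiberFunctor x).finiteIndex_range
    (P := EtaleFundamentalGroup.baseChange f)
    (.of_iso (EtaleFundamentalGroup.fiberBaseChangeIso f x).symm
      (EtaleFundamentalGroup.hasDominatingPoints_fiberFunctor (x ≫ f))) n hn
  refine ⟨?_⟩
  rw [EtaleFundamentalGroup.pi1Map, MonoidHom.range_comp]
  exact (Subgroup.index_map_equiv _ (EtaleFundamentalGroup.fiberBaseChangeIso f x).conjAut).trans_ne
    h.index_ne_zero
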